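/- Let $m,n\ge 1$ be integers. For $\mathbf{x}\in\mathbb{R}^n$ let $S^-(\mathbf{x})$ denote the number of sign changes in the sequence $x_1,\dots,x_n$ after discarding all zero entries, with $S^-(\mathbf{0}):=0$. Let $\epsilon=(\epsilon_1,\dots,\epsilon_{\min\{m,n\}})$ with every $\epsilon_r\in\{1,-1\}$, and put $\epsilon_0:=1$. A matrix $A\in\mathbb{R}^{m\times n}$ is called $\mathrm{SR}(\epsilon)$ if, for every $1\le r\le\min\{m,n\}$, every non-zero $r\times r$ minor of $A$ has sign $\epsilon_r$. Let $A\in\mathbb{R}^{m\times n}$. For every $k\times k$ submatrix $A_k$ of $A$ (given by $k$ increasing row indices and $k$ increasing column indices, $1\le k\le\min\{m,n\}$) fix an arbitrary vector $\boldsymbol{\alpha}^{A_k}=(\alpha_1,-\alpha_2,\dots,(-1)^{k-1}\alpha_k)^T\in\mathbb{R}^k$ with all $\alpha_j>0$, and put $\mathbf{y}^{A_k}:=\operatorname{adj}(A_k)\,\boldsymbol{\alpha}^{A_k}$, where the adjugate of a $1\times1$ matrix is $(1)$. Then, for any such choice of the vectors $\boldsymbol{\alpha}^{A_k}$, the following are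 equivalent. 1. $A$ is $\mathrm{SR}(\epsilon)$. 2. For all $\mathbf{x}\in\mathbb{R}^n$ we have $S^-(A\mathbf{x})\le S^-(\mathbf{x})$. Moreover, for all $\mathbf{x}\in\mathbb{R}^n$ with $A\mathbf{x}\ne\mathbf{0}$ and $S^-(A\mathbf{x})=S^-(\mathbf{x})=r$, if $0\le r\le\min\{m,n\}-1$, then the sign of the first (respectively last) non-zero component of $A\mathbf{x}$ equals $\epsilon_r\epsilon_{r+1}$ times the sign of the first (respectively last) non-zero component of $\mathbf{x}$. 3. For every $1\le k\le\min\{m,n\}$ and every $k\times k$ submatrix $A_k$ of $A$ we have $S^-(A_k\mathbf{y}^{A_k})\le S^-(\mathbf{y}^{A_k})$. Moreover, if $A_k\mathbf{y}^{A_k}\ne\mathbf{0}$ and $S^-(A_k\mathbf{y}^{A_k})=S^-(\mathbf{y}^{A_k})=r$ with $0\le r\le k-1$, then the sign of the first (respectively last) non-zero component of $A_k\mathbf{y}^{A_k}$ equals $\epsilon_r\epsilon_{r+1}$ times the sign of the first (respectively last) non-zero component of $\mathbf{y}^{A_k}$. -/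

import Mathlib

noncomputable section

namespace SignRegular

/-- The signs of the non-zero entries of `x`, in order. -/
def nonzeroSigns {n : ℕ} (x : Fin n → ℝ) : List SignType :=
  ((List.ofFn x).map SignType.sign).filter (· ≠ 0)

/-- `S⁻(x)`: the number of sign changes in `x` after discarding all zero entries. Collapsing runs
of equal signs leaves one entry more than there are sign changes; the zero vector gives `0`. -/
def signChanges {n : ℕ} (x : Fin n → ℝ) : ℕ :=
  ((nonzeroSigns x).destutter (· ≠ ·)).length - 1

/-- The sign of the first non-zero entry of `x` (and `0` for the zero vector). -/
def firstSign {n : ℕ} (x : Fin n → ℝ) : SignType := (nonzeroSigns x).headD 0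

/-- The sign of the last non-zero entry of `x` (and `0` for the zero vector). -/
def lastSign {n : ℕ} (x : Fin n → ℝ) : SignType := (nonzeroSigns x).getLastD 0

/-- The entry `ε_r` of a sign pattern `(ε_1, …, ε_N)`, with `ε_0 = 1`.
Indices above `N` are never used. -/
def sgn {N : ℕ} (ε : Fin N → SignType) (r : ℕ) : SignType :=
  if h : 1 ≤ r ∧ r ≤ N then ε ⟨r - 1, by omega⟩ else 1

/-- `A` is SR(ε): every non-zero `r × r` minor of `A` has sign `ε_r`, for `1 ≤ r ≤ min m n`. -/
def IsSR {m n : ℕ} (ε : Fin (min m n) → SignType) (A : Matrix (Fin m) (Fin n) ℝ) : Prop :=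
  ∀ r : ℕ, 1 ≤ r → r ≤ min m n → ∀ (I : Fin r ↪o Fin m) (J : Fin r ↪o Fin n),
    (A.submatrix I J).det ≠ 0 → SignType.sign (A.submatrix I J).det = sgn ε r

/-- The variation diminishing condition for the matrix `B` at the vector `x`, with the sign
condition (relative to the pattern `ε`) in the case of equality. -/
def VDAt {N p q : ℕ} (ε : Fin N → SignType) (B : Matrix (Fin p) (Fin q) ℝ)
    (x : Fin q → ℝ) : Prop :=
  signChanges (B.mulVec x) ≤ signChanges x ∧
  ∀ r : ℕ, B.mulVec x ≠ 0 → signChanges (B.mulVec x) = r → signChanges x = r →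
    r < min p q →
      firstSign (B.mulVec x) = sgn ε r * sgn ε (r + 1) * firstSign x ∧
      lastSign (B.mulVec x) = sgn ε r * sgn ε (r + 1) * lastSign x

/-- The vector `(a_1, -a_2, …, (-1)^(k-1) a_k)`. -/
def alternating {k : ℕ} (a : Fin k → ℝ) : Fin k → ℝ := fun i => (-1) ^ (i : ℕ) * a i

end SignRegular

end

/-!
`k` sign changes of `A x` are witnessed by `k + 1` rows of `A`, so for 1 → 2 let `A` have `k + 1`
rows. As long as `A` has a kernel, `x` can be moved along it inside its closed orthant until an
entry vanishes and a column drops out, which cannot create sign changes of `x`. Once `A` is square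
and invertible, `det A • x = adj(A) (A x)`, and the checkerboard signs of the adjugate match those
of the alternating vector `A x`: all terms of each entry have the same sign, so `x` alternates too.

For 3 → 1 the same computation shows that `y = adj(A_k) α` alternates, while `A_k y = det(A_k) α`;
comparing first signs gives the sign of `det A_k`, by induction on `k`.
-/

namespace SignRegular

open Matrix
open scoped List

theorem exists_adjugate_apply_ne_zero {R ι : Type*} [CommRing R] [Fintype ι] [DecidableEq ι]
    {B : Matrix ι ι R} (hB : B.det ≠ 0) (i : ι) : ∃ j, B.adjugate i j ≠ 0 := by
  by_contra! h
  apply hB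
  calc B.det = (B.adjugate * B) i i := by simp [adjugate_mul]
    _ = 0 := by simp [Matrix.mul_apply, h]

theorem exists_mulVec_eq_zero_of_card_lt {K m n : Type*} [Field K] [Fintype m] [Fintype n]
    (hmn : Fintype.card m < Fintype.card n) (A : Matrix m n K) : ∃ w ≠ 0, A *ᵥ w = 0 := by
  have hker := A.mulVecLin.ker_ne_bot_of_finrank_lt (by simpa using hmn)
  obtain ⟨w, hw, hw0⟩ := Submodule.exists_mem_ne_zero_of_ne_bot hker
  exact ⟨w, hw0, hw⟩

section OrderedField

variable {R : Type*} [LinearOrder R]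

/-- The entries of `x` are non-zero and of alternating signs, starting with the sign `s`. -/
structure AlternatesFrom [Zero R] {k : ℕ} (s : SignType) (x : Fin k → R) : Prop where
  ne_zero : s ≠ 0
  sign_apply (j : Fin k) : SignType.sign (x j) = s * (-1) ^ (j : ℕ)

/-- Some `k + 1` entries of `x`, taken in order, alternate in sign starting with the sign `s`.
Over all `s`, the largest such `k` is the number of sign changes of `x`. -/
def HasAlternation [Zero R] {n : ℕ} (x : Fin n → R) (k : ℕ) (s : SignType) : Prop :=
  ∃ g : Fin (k + 1) ↪o Fin n, AlternatesFrom s (x ∘ g)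

/-- Every non-zero minor of `A` of size `r` has sign `δ r`. As the empty minor is `1`, this forces
`δ 0 = 1`; `δ r = 0` says that all minors of size `r` vanish. -/
def HasMinorSigns [CommRing R] {m n : ℕ} (δ : ℕ → SignType) (A : Matrix (Fin m) (Fin n) R) :
    Prop :=
  ∀ (r : ℕ) (I : Fin r ↪o Fin m) (J : Fin r ↪o Fin n),
    (A.submatrix I J).det ≠ 0 → SignType.sign (A.submatrix I J).det = δ r

theorem AlternatesFrom.apply_ne_zero [Zero R] {k : ℕ} {s : SignType} {x : Fin k → R}
    (h : AlternatesFrom s x) (j : Fin k) : x j ≠ 0 := by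
  rw [← sign_ne_zero, h.sign_apply]
  exact mul_ne_zero h.ne_zero (pow_ne_zero _ (by decide))

theorem AlternatesFrom.hasAlternation [Zero R] {k : ℕ} {s : SignType} {x : Fin (k + 1) → R}
    (h : AlternatesFrom s x) : HasAlternation x k s :=
  ⟨RelEmbedding.refl _, h⟩

theorem HasAlternation.alternatesFrom [Zero R] {k : ℕ} {s : SignType} {x : Fin (k + 1) → R}
    (h : HasAlternation x k s) : AlternatesFrom s x := by
  obtain ⟨g, hg⟩ := h
  have hid : ⇑g = id := (g.strictMono.range_inj strictMono_id).1 <| by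
    rw [(Finite.injective_iff_surjective.1 g.injective).range_eq, Set.range_id]
  rwa [hid] at hg

theorem HasAlternation.ne_zero [Zero R] {n k : ℕ} {s : SignType} {x : Fin n → R}
    (h : HasAlternation x k s) : x ≠ 0 := by
  rintro rfl
  obtain ⟨g, hg⟩ := h
  exact hg.apply_ne_zero 0 rfl

theorem HasAlternation.sign_ne_zero [Zero R] {n k : ℕ} {s : SignType} {x : Fin n → R}
    (h : HasAlternation x k s) : s ≠ 0 :=
  h.choose_spec.ne_zero

theorem HasAlternation.lt_card [Zero R] {n k : ℕ} {s : SignType} {x : Fin n → R}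
    (h : HasAlternation x k s) : k < n := by
  obtain ⟨g, -⟩ := h
  simpa using Fintype.card_le_of_embedding g.toEmbedding

theorem HasAlternation.of_sign_eq [Zero R] {m n k : ℕ} {s : SignType} {x : Fin m → R}
    {y : Fin n → R} (h : HasAlternation x k s) (J : Fin m ↪o Fin n)
    (hxy : ∀ j, x j ≠ 0 → SignType.sign (x j) = SignType.sign (y (J j))) :
    HasAlternation y k s := by
  obtain ⟨g, hg⟩ := h
  refine ⟨g.trans J, hg.ne_zero, fun j => ?_⟩
  rw [← hg.sign_apply j]
  exact (hxy _ (hg.apply_ne_zero j)).symm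

theorem HasAlternation.of_comp [Zero R] {m n k : ℕ} {s : SignType} {x : Fin n → R}
    {J : Fin m ↪o Fin n} (h : HasAlternation (x ∘ J) k s) : HasAlternation x k s :=
  h.of_sign_eq J fun _ _ => rfl

theorem HasMinorSigns.submatrix [CommRing R] {m n p q : ℕ} {δ : ℕ → SignType}
    {A : Matrix (Fin m) (Fin n) R} (h : HasMinorSigns δ A) {I : Fin p → Fin m} (hI : StrictMono I)
    {J : Fin q → Fin n} (hJ : StrictMono J) : HasMinorSigns δ (A.submatrix I J) :=
  fun r I' J' => h r (I'.trans (OrderEmbedding.ofStrictMono I hI))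
    (J'.trans (OrderEmbedding.ofStrictMono J hJ))

theorem sign_sum_of_ne_zero [CommRing R] [IsStrictOrderedRing R] {ι : Type*} [Fintype ι]
    {f : ι → R} {t : SignType} (hf : ∀ i, f i ≠ 0 → SignType.sign (f i) = t)
    (hne : ∃ i, f i ≠ 0) : SignType.sign (∑ i, f i) = t := by
  rw [← Finset.sum_filter_ne_zero]
  obtain ⟨i, hi⟩ := hne
  exact sign_sum ⟨i, by simpa using hi⟩ t fun j hj => hf j (Finset.mem_filter.1 hj).2

theorem alternatesFrom_adjugate_mulVec [CommRing R] [IsStrictOrderedRing R] {k : ℕ}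
    {B : Matrix (Fin (k + 1)) (Fin (k + 1)) R} {e s : SignType} {v : Fin (k + 1) → R}
    (hminor : ∀ i j : Fin (k + 1), (B.submatrix i.succAbove j.succAbove).det ≠ 0 →
      SignType.sign (B.submatrix i.succAbove j.succAbove).det = e)
    (hdet : B.det ≠ 0) (hv : AlternatesFrom s v) : AlternatesFrom (e * s) (B.adjugate *ᵥ v) := by
  have hadj (i j : Fin (k + 1)) (h : B.adjugate i j ≠ 0) :
      SignType.sign (B.adjugate i j) = e * (-1) ^ (j + i : ℕ) := by
    rw [adjugate_fin_succ_eq_det_submatrix] at h ⊢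
    rw [sign_mul, hminor j i (right_ne_zero_of_mul h), sign_pow, Left.sign_neg, sign_one, mul_comm]
  have he : e ≠ 0 := by
    obtain ⟨j, hj⟩ := exists_adjugate_apply_ne_zero hdet 0
    have := sign_ne_zero.2 hj
    rw [hadj 0 j hj] at this
    exact left_ne_zero_of_mul this
  refine ⟨mul_ne_zero he hv.ne_zero, fun i => ?_⟩
  obtain ⟨j, hj⟩ := exists_adjugate_apply_ne_zero hdet i
  have hjv : B.adjugate i j * v j ≠ 0 := mul_ne_zero hj (hv.apply_ne_zero j)
  refine sign_sum_of_ne_zero (fun j hj => ?_) ⟨j, hjv⟩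
  rw [sign_mul, hadj i j (left_ne_zero_of_mul hj), hv.sign_apply, pow_add]
  have hsq : ((-1 : SignType) ^ (j : ℕ)) * (-1) ^ (j : ℕ) = 1 := by
    rw [← mul_pow]; simp
  calc e * ((-1) ^ (j : ℕ) * (-1) ^ (i : ℕ)) * (s * (-1) ^ (j : ℕ))
      = e * s * (-1) ^ (i : ℕ) * ((-1) ^ (j : ℕ) * (-1) ^ (j : ℕ)) := by ac_rfl
    _ = e * s * (-1) ^ (i : ℕ) := by rw [hsq, mul_one]

theorem HasMinorSigns.alternatesFrom_of_mulVec [CommRing R] [IsStrictOrderedRing R] {k : ℕ}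
    {δ : ℕ → SignType} {B : Matrix (Fin (k + 1)) (Fin (k + 1)) R} (hB : HasMinorSigns δ B)
    (hdet : B.det ≠ 0) {s : SignType} {x : Fin (k + 1) → R} (hx : AlternatesFrom s (B *ᵥ x)) :
    AlternatesFrom (δ k * δ (k + 1) * s) x := by
  have hdetx : AlternatesFrom (δ k * s) (B.det • x) := by
    have := alternatesFrom_adjugate_mulVec
      (fun i j => hB k (Fin.succAboveOrderEmb i) (Fin.succAboveOrderEmb j)) hdet hx
    rwa [mulVec_mulVec, adjugate_mul, smul_mulVec, one_mulVec] at this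
  have hδ : SignType.sign B.det = δ (k + 1) :=
    hB (k + 1) (RelEmbedding.refl _) (RelEmbedding.refl _) hdet
  have hδ0 : δ (k + 1) ≠ 0 := hδ ▸ sign_ne_zero.2 hdet
  refine ⟨?_, fun j => ?_⟩
  · rw [mul_right_comm]
    exact mul_ne_zero hdetx.ne_zero hδ0
  · have h := hdetx.sign_apply j
    rw [Pi.smul_apply, smul_eq_mul, sign_mul, hδ] at h
    have cancel : ∀ d t u : SignType, d ≠ 0 → d * t = u → t = d * u := by decide
    rw [cancel _ _ _ hδ0 h]
    ac_rfl

theorem sign_sub_of_abs_le [AddCommGroup R] [IsOrderedAddMonoid R] {a b : R} (hab : |b| ≤ |a|)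
    (hne : a - b ≠ 0) : SignType.sign (a - b) = SignType.sign a := by
  rcases lt_trichotomy a 0 with ha | rfl | ha
  · rw [abs_of_neg ha] at hab
    have hab' : a ≤ b := neg_le_neg_iff.1 ((neg_le_abs b).trans hab)
    rw [sign_neg ha, sign_neg ((sub_nonpos.2 hab').lt_of_ne hne)]
  · simp_all
  · rw [abs_of_pos ha] at hab
    have hba : b ≤ a := (le_abs_self b).trans hab
    rw [sign_pos ha, sign_pos ((sub_nonneg.2 hba).lt_of_ne' hne)]

section Field

variable [Field R] [IsStrictOrderedRing R]

theorem exists_sub_smul_apply_eq_zero {ι : Type*} [Finite ι] (x : ι → R) {w : ι → R}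
    (hw : w ≠ 0) : ∃ (t : R) (c : ι), (x - t • w) c = 0 ∧
      ∀ j, (x - t • w) j ≠ 0 → SignType.sign ((x - t • w) j) = SignType.sign (x j) := by
  classical
  have := Fintype.ofFinite ι
  obtain ⟨i, hi⟩ := Function.ne_iff.1 hw
  obtain ⟨c, hc, hmin⟩ := Finset.exists_min_image {j | w j ≠ 0} (fun j => |x j / w j|)
    ⟨i, by simpa using hi⟩
  have hwc : w c ≠ 0 := by simpa using hc
  refine ⟨x c / w c, c, by simp [hwc], fun j hj => sign_sub_of_abs_le ?_ hj⟩
  by_cases hwj : w j = 0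
  · simp [hwj]
  · calc |x c / w c * w j| = |x c / w c| * |w j| := abs_mul _ _
      _ ≤ |x j / w j| * |w j| :=
        mul_le_mul_of_nonneg_right (hmin j (by simpa using hwj)) (abs_nonneg _)
      _ = |x j| := by rw [← abs_mul, div_mul_cancel₀ _ hwj]

/-- Moving `x` along a kernel vector keeps `A *ᵥ x`; stop as soon as an entry `c` vanishes, before
any sign changes. -/
theorem exists_submatrix_mulVec_eq {m n : ℕ} {A : Matrix (Fin m) (Fin (n + 1)) R}
    (hA : ∃ w ≠ 0, A *ᵥ w = 0) (x : Fin (n + 1) → R) :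
    ∃ (c : Fin (n + 1)) (y : Fin n → R), A.submatrix id c.succAbove *ᵥ y = A *ᵥ x ∧
      ∀ j, y j ≠ 0 → SignType.sign (y j) = SignType.sign (x (c.succAbove j)) := by
  obtain ⟨w, hw, hAw⟩ := hA
  obtain ⟨t, c, hc, hsign⟩ := exists_sub_smul_apply_eq_zero x hw
  refine ⟨c, (x - t • w) ∘ c.succAbove, ?_, fun j => hsign _⟩
  calc A.submatrix id c.succAbove *ᵥ ((x - t • w) ∘ c.succAbove)
      = A *ᵥ (x - t • w) := by
        ext i
        simp only [mulVec, dotProduct, Fin.sum_univ_succAbove _ c, hc, mul_zero, zero_add]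
        rfl
    _ = A *ᵥ x := by rw [mulVec_sub, mulVec_smul, hAw, smul_zero, sub_zero]

theorem HasMinorSigns.hasAlternation_of_alternatesFrom_mulVec {k n : ℕ} {δ : ℕ → SignType}
    {A : Matrix (Fin (k + 1)) (Fin n) R} (hA : HasMinorSigns δ A) {s : SignType} {x : Fin n → R}
    (hx : AlternatesFrom s (A *ᵥ x)) : HasAlternation x k (δ k * δ (k + 1) * s) := by
  induction n generalizing k s with
  | zero => exact absurd (by simp [mulVec, dotProduct]) (hx.apply_ne_zero 0)
  | succ n ih =>
    have of_ker {k : ℕ} {A : Matrix (Fin (k + 1)) (Fin (n + 1)) R} (hA : HasMinorSigns δ A)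
        {s : SignType} (hx : AlternatesFrom s (A *ᵥ x)) (hker : ∃ w ≠ 0, A *ᵥ w = 0) :
        HasAlternation x k (δ k * δ (k + 1) * s) := by
      obtain ⟨c, y, hy, hsign⟩ := exists_submatrix_mulVec_eq hker x
      rw [← hy] at hx
      exact (ih (hA.submatrix strictMono_id (Fin.strictMono_succAbove c)) hx).of_sign_eq
        (Fin.succAboveOrderEmb c) hsign
    have square {B : Matrix (Fin (n + 1)) (Fin (n + 1)) R} (hB : HasMinorSigns δ B)
        {s : SignType} (hx : AlternatesFrom s (B *ᵥ x)) :
        AlternatesFrom (δ n * δ (n + 1) * s) x := by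
      by_cases hdet : B.det = 0
      · exact (of_ker hB hx (exists_mulVec_eq_zero_iff.2 hdet)).alternatesFrom
      · exact hB.alternatesFrom_of_mulVec hdet hx
    rcases lt_trichotomy k n with hkn | rfl | hnk
    · exact of_ker hA hx (exists_mulVec_eq_zero_of_card_lt (by simpa using hkn) A)
    · exact (square hA hx).hasAlternation
    · -- The two windows of `n + 1` consecutive rows give opposite signs for `x 0`.
      let I : Fin (n + 1) ↪o Fin (k + 1) := Fin.castLEOrderEmb (by lia)
      let I' : Fin (n + 1) ↪o Fin (k + 1) :=
        (Fin.succOrderEmb (n + 1)).trans (Fin.castLEOrderEmb (by lia))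
      have hI : AlternatesFrom s (A.submatrix I id *ᵥ x) :=
        ⟨hx.ne_zero, fun j => hx.sign_apply (I j)⟩
      have hI' : AlternatesFrom (-s) (A.submatrix I' id *ᵥ x) := by
        refine ⟨by simpa using hx.ne_zero, fun j => (hx.sign_apply (I' j)).trans ?_⟩
        simp [I', pow_succ]
      have h := square (hA.submatrix I.strictMono strictMono_id) hI
      have h' := square (hA.submatrix I'.strictMono strictMono_id) hI'
      have hsign := (h.sign_apply 0).symm.trans (h'.sign_apply 0)
      have : δ n * δ (n + 1) * s = 0 := by simpa using hsign
      exact absurd this h.ne_zero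

theorem HasMinorSigns.hasAlternation_of_mulVec {m n k : ℕ} {δ : ℕ → SignType}
    {A : Matrix (Fin m) (Fin n) R} (hA : HasMinorSigns δ A) {s : SignType} {x : Fin n → R}
    (hx : HasAlternation (A *ᵥ x) k s) : HasAlternation x k (δ k * δ (k + 1) * s) := by
  obtain ⟨g, hg⟩ := hx
  exact (hA.submatrix g.strictMono strictMono_id).hasAlternation_of_alternatesFrom_mulVec hg

end Field

end OrderedField

section List

theorem sublist_ofFn_iff {α : Type*} {n k : ℕ} {f : Fin n → α} {l : List α} (hl : l.length = k) :
    l <+ List.ofFn f ↔ ∃ g : Fin k ↪o Fin n, l = List.ofFn (f ∘ g) := by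
  subst hl
  let e : Fin (List.ofFn f).length ≃o Fin n := Fin.castOrderIso List.length_ofFn
  rw [List.sublist_iff_exists_fin_orderEmbedding_get_eq]
  constructor
  · rintro ⟨g, hg⟩
    refine ⟨g.trans e.toOrderEmbedding, List.ext_get (by simp) fun i hi _ => ?_⟩
    rw [hg ⟨i, hi⟩]
    simp [e, Fin.cast]
  · rintro ⟨g, hg⟩
    refine ⟨g.trans e.symm.toOrderEmbedding, fun i => ?_⟩
    conv_lhs => rw [List.get_of_eq hg]
    simp [e]

theorem head?_eq_of_longest_isChain_ne {α : Type*} {l c : List α} (hcl : c <+ l)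
    (hc : c.IsChain (· ≠ ·))
    (hmax : ∀ d, d <+ l → d.IsChain (· ≠ ·) → d.length ≤ c.length) : c.head? = l.head? := by
  rcases l with _ | ⟨a, l⟩
  · rw [List.sublist_nil.1 hcl]
  rcases c with _ | ⟨b, c⟩
  · simpa using hmax [a] (by simp) (by simp)
  by_contra hne
  have hab : a ≠ b := fun h => hne (by simp [h])
  have hcl' : b :: c <+ l := by
    rcases List.sublist_cons_iff.1 hcl with h | ⟨c', hc', -⟩
    · exact h
    · exact absurd (List.cons_eq_cons.1 hc').1.symm hab
  simpa using hmax (a :: b :: c) (hcl'.cons_cons a) (hc.cons_cons hab)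

theorem getLast?_eq_of_longest_isChain_ne {α : Type*} {l c : List α} (hcl : c <+ l)
    (hc : c.IsChain (· ≠ ·))
    (hmax : ∀ d, d <+ l → d.IsChain (· ≠ ·) → d.length ≤ c.length) :
    c.getLast? = l.getLast? := by
  have isChain_reverse {d : List α} (hd : d.IsChain (· ≠ ·)) : d.reverse.IsChain (· ≠ ·) :=
    List.isChain_reverse.2 (hd.imp fun _ _ => Ne.symm)
  rw [← List.head?_reverse, ← List.head?_reverse]
  refine head?_eq_of_longest_isChain_ne hcl.reverse (isChain_reverse hc) fun d hdl hd => ?_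
  simpa using hmax d.reverse (List.reverse_reverse l ▸ hdl.reverse) (isChain_reverse hd)

/-- The list `s, -s, s, …` of `k + 1` alternating signs. -/
def alternatingSigns (k : ℕ) (s : SignType) : List SignType :=
  List.ofFn fun j : Fin (k + 1) => s * (-1) ^ (j : ℕ)

theorem length_alternatingSigns (k : ℕ) (s : SignType) : (alternatingSigns k s).length = k + 1 :=
  List.length_ofFn

theorem getElem_alternatingSigns (k : ℕ) (s : SignType) (i : ℕ)
    (hi : i < (alternatingSigns k s).length) : (alternatingSigns k s)[i] = s * (-1) ^ i :=
  List.getElem_ofFn _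

theorem headD_alternatingSigns (k : ℕ) (s : SignType) : (alternatingSigns k s).headD 0 = s := by
  simp [alternatingSigns, List.ofFn_succ]

theorem getLastD_alternatingSigns (k : ℕ) (s : SignType) :
    (alternatingSigns k s).getLastD 0 = s * (-1) ^ k := by
  rw [alternatingSigns, List.ofFn_succ', List.concat_eq_append]
  simp

theorem ne_zero_of_mem_alternatingSigns {k : ℕ} {s t : SignType} (hs : s ≠ 0)
    (ht : t ∈ alternatingSigns k s) : t ≠ 0 := by
  obtain ⟨j, rfl⟩ := List.mem_ofFn.1 ht
  exact mul_ne_zero hs (pow_ne_zero _ (by decide))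

theorem isChain_alternatingSigns (k : ℕ) {s : SignType} (hs : s ≠ 0) :
    (alternatingSigns k s).IsChain (· ≠ ·) := by
  refine List.isChain_ofFn.2 fun i hi => ?_
  have : s * (-1) ^ i ≠ 0 := mul_ne_zero hs (pow_ne_zero _ (by decide))
  simpa [pow_succ, SignType.self_eq_neg_iff] using this

theorem exists_eq_alternatingSigns {l : List SignType} (hl : l ≠ []) (hl0 : ∀ t ∈ l, t ≠ 0)
    (hchain : l.IsChain (· ≠ ·)) : ∃ s ≠ 0, l = alternatingSigns (l.length - 1) s := by
  have hpos : 0 < l.length := List.length_pos_iff.2 hl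
  have flip : ∀ t u : SignType, t ≠ 0 → u ≠ 0 → t ≠ u → u = t * -1 := by decide
  have hget : ∀ (i : ℕ) (hi : i < l.length), l[i] = l[0] * (-1) ^ i := by
    intro i
    induction i with
    | zero => simp
    | succ i ih =>
      intro hi
      rw [pow_succ, ← mul_assoc, ← ih (by lia)]
      exact flip _ _ (hl0 _ (List.getElem_mem _)) (hl0 _ (List.getElem_mem _))
        (List.isChain_iff_getElem.1 hchain i hi)
  refine ⟨l[0], hl0 _ (List.getElem_mem _), List.ext_getElem ?_ fun i hi _ => ?_⟩
  · rw [length_alternatingSigns]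
    lia
  · rw [hget i hi, getElem_alternatingSigns]

end List

section SignChanges

variable {n : ℕ}

theorem nonzeroSigns_eq_filter_ofFn (x : Fin n → ℝ) :
    nonzeroSigns x = (List.ofFn (SignType.sign ∘ x)).filter (· ≠ 0) := by
  rw [nonzeroSigns, List.map_ofFn]

theorem nonzeroSigns_ne_nil {x : Fin n → ℝ} (hx : x ≠ 0) : nonzeroSigns x ≠ [] := by
  obtain ⟨j, hj⟩ := Function.ne_iff.1 hx
  have : SignType.sign (x j) ∈ nonzeroSigns x := by
    simpa [nonzeroSigns_eq_filter_ofFn, List.mem_ofFn] using hj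
  exact List.ne_nil_of_mem this

theorem signChanges_zero : signChanges (0 : Fin n → ℝ) = 0 := by
  have : nonzeroSigns (0 : Fin n → ℝ) = [] := by
    simp [nonzeroSigns_eq_filter_ofFn, List.filter_eq_nil_iff, List.mem_ofFn]
  simp [signChanges, this]

theorem length_destutter_nonzeroSigns {x : Fin n → ℝ} (hx : x ≠ 0) :
    ((nonzeroSigns x).destutter (· ≠ ·)).length = signChanges x + 1 := by
  have : 0 < ((nonzeroSigns x).destutter (· ≠ ·)).length :=
    List.length_pos_iff.2 (mt (List.destutter_eq_nil _).1 (nonzeroSigns_ne_nil hx))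
  rw [signChanges]
  lia

theorem hasAlternation_iff_sublist {k : ℕ} {s : SignType} {x : Fin n → ℝ} :
    HasAlternation x k s ↔ s ≠ 0 ∧ alternatingSigns k s <+ nonzeroSigns x := by
  have hfilter (hs : s ≠ 0) : (alternatingSigns k s).filter (· ≠ 0) = alternatingSigns k s :=
    List.filter_eq_self.2 fun t ht => by simpa using ne_zero_of_mem_alternatingSigns hs ht
  rw [nonzeroSigns_eq_filter_ofFn]
  constructor
  · rintro ⟨g, hs, hg⟩
    refine ⟨hs, hfilter hs ▸ List.Sublist.filter _ ?_⟩
    exact (sublist_ofFn_iff (length_alternatingSigns k s)).2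
      ⟨g, congrArg List.ofFn (funext fun j => (hg j).symm)⟩
  · rintro ⟨hs, h⟩
    obtain ⟨g, hg⟩ := (sublist_ofFn_iff (length_alternatingSigns k s)).1
      (h.trans List.filter_sublist)
    exact ⟨g, hs, fun j => (congrFun (List.ofFn_injective hg) j).symm⟩

theorem exists_hasAlternation_signChanges {x : Fin n → ℝ} (hx : x ≠ 0) :
    ∃ s, HasAlternation x (signChanges x) s := by
  set l := (nonzeroSigns x).destutter (· ≠ ·)
  have hsub : l <+ nonzeroSigns x := List.destutter_sublist _ _
  obtain ⟨s, hs, hl⟩ := exists_eq_alternatingSigns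
    (mt (List.destutter_eq_nil _).1 (nonzeroSigns_ne_nil hx))
    (fun t ht => by simpa using (List.mem_filter.1 (hsub.subset ht)).2)
    (List.isChain_destutter _ _)
  exact ⟨s, hasAlternation_iff_sublist.2 ⟨hs, hl ▸ hsub⟩⟩

theorem HasAlternation.le_signChanges {k : ℕ} {s : SignType} {x : Fin n → ℝ}
    (h : HasAlternation x k s) : k ≤ signChanges x := by
  obtain ⟨hs, hsub⟩ := hasAlternation_iff_sublist.1 h
  have := (isChain_alternatingSigns k hs).length_le_length_destutter_ne hsub
  rw [length_alternatingSigns, length_destutter_nonzeroSigns h.ne_zero] at this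
  lia

theorem HasAlternation.length_le_of_isChain {s : SignType} {x : Fin n → ℝ}
    (h : HasAlternation x (signChanges x) s) (l : List SignType) (hl : l <+ nonzeroSigns x)
    (hchain : l.IsChain (· ≠ ·)) : l.length ≤ (alternatingSigns (signChanges x) s).length := by
  rw [length_alternatingSigns, ← length_destutter_nonzeroSigns h.ne_zero]
  exact hchain.length_le_length_destutter_ne hl

theorem HasAlternation.firstSign_eq {s : SignType} {x : Fin n → ℝ}
    (h : HasAlternation x (signChanges x) s) : firstSign x = s := by
  obtain ⟨hs, hsub⟩ := hasAlternation_iff_sublist.1 h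
  rw [firstSign, List.headD_eq_head?_getD, ← head?_eq_of_longest_isChain_ne hsub
    (isChain_alternatingSigns _ hs) h.length_le_of_isChain, ← List.headD_eq_head?_getD,
    headD_alternatingSigns]

theorem HasAlternation.lastSign_eq {s : SignType} {x : Fin n → ℝ}
    (h : HasAlternation x (signChanges x) s) : lastSign x = s * (-1) ^ signChanges x := by
  obtain ⟨hs, hsub⟩ := hasAlternation_iff_sublist.1 h
  rw [lastSign, List.getLastD_eq_getLast?, ← getLast?_eq_of_longest_isChain_ne hsub
    (isChain_alternatingSigns _ hs) h.length_le_of_isChain, ← List.getLastD_eq_getLast?,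
    getLastD_alternatingSigns]

theorem hasAlternation_signChanges {x : Fin n → ℝ} (hx : x ≠ 0) :
    HasAlternation x (signChanges x) (firstSign x) := by
  obtain ⟨s, hs⟩ := exists_hasAlternation_signChanges hx
  rwa [hs.firstSign_eq]

theorem lastSign_eq_firstSign_mul {x : Fin n → ℝ} (hx : x ≠ 0) :
    lastSign x = firstSign x * (-1) ^ signChanges x :=
  (hasAlternation_signChanges hx).lastSign_eq

theorem signChanges_le (x : Fin (n + 1) → ℝ) : signChanges x ≤ n := by
  by_cases hx : x = 0
  · simp [hx, signChanges_zero]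
  · exact Nat.lt_succ_iff.1 (hasAlternation_signChanges hx).lt_card

theorem HasAlternation.of_extend_zero {m k : ℕ} {s : SignType} {y : Fin m → ℝ} {J : Fin m ↪o Fin n}
    (h : HasAlternation (Function.extend J y 0) k s) : HasAlternation y k s := by
  obtain ⟨g, hg⟩ := h
  have hrange (i : Fin (k + 1)) : ∃ j, J j = g i := by
    by_contra h
    exact hg.apply_ne_zero i (Function.extend_apply' _ _ _ h)
  choose g' hg' using hrange
  have hmono : StrictMono g' := fun i j hij => by
    rw [← J.lt_iff_lt, hg', hg']
    exact g.strictMono hij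
  refine ⟨OrderEmbedding.ofStrictMono g' hmono, hg.ne_zero, fun j => ?_⟩
  rw [← hg.sign_apply j, Function.comp_apply, Function.comp_apply, ← hg', J.injective.extend_apply]
  rfl

theorem signChanges_extend_zero_le {m : ℕ} (y : Fin m → ℝ) (J : Fin m ↪o Fin n) :
    signChanges (Function.extend J y 0) ≤ signChanges y := by
  by_cases hz : Function.extend J y 0 = 0
  · simp [hz, signChanges_zero]
  · exact (hasAlternation_signChanges hz).of_extend_zero.le_signChanges

end SignChanges

section VariationDiminishing

variable {m n : ℕ}

theorem vdAt_iff_hasAlternation {N p q : ℕ} {ε : Fin N → SignType} {B : Matrix (Fin p) (Fin q) ℝ}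
    {x : Fin q → ℝ} :
    VDAt ε B x ↔ ∀ k s, signChanges x ≤ k → HasAlternation (B *ᵥ x) k s →
      HasAlternation x k (sgn ε k * sgn ε (k + 1) * s) := by
  have cancel : ∀ d t u : SignType, t ≠ 0 → t = d * u → u = d * t := by decide
  constructor
  · rintro ⟨hle, heq⟩ k s hxk hBx
    obtain rfl : signChanges x = k := le_antisymm hxk (hBx.le_signChanges.trans hle)
    have hS : signChanges (B *ᵥ x) = signChanges x := le_antisymm hle hBx.le_signChanges
    have hx : HasAlternation x (signChanges x) (firstSign x) :=
      hasAlternation_signChanges (by rintro rfl; exact hBx.ne_zero (mulVec_zero B))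
    have hfirst : firstSign (B *ᵥ x) = s := HasAlternation.firstSign_eq (hS.symm ▸ hBx)
    have hsign := (heq _ hBx.ne_zero hS rfl (lt_min hBx.lt_card hx.lt_card)).1
    rw [hfirst] at hsign
    rwa [← cancel _ _ _ hBx.sign_ne_zero hsign]
  · intro h
    by_cases hBx : B *ᵥ x = 0
    · exact ⟨by simp [hBx, signChanges_zero], fun _ hne => absurd hBx hne⟩
    have hBS := hasAlternation_signChanges hBx
    have hle : signChanges (B *ᵥ x) ≤ signChanges x := by
      by_contra! hlt
      exact hlt.not_ge (h _ _ hlt.le hBS).le_signChanges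
    refine ⟨hle, fun r _ hBr hxr _ => ?_⟩
    subst hxr
    have hxS := h _ _ le_rfl (hBr ▸ hBS)
    have hfirst : firstSign (B *ᵥ x) =
        sgn ε (signChanges x) * sgn ε (signChanges x + 1) * firstSign x :=
      cancel _ _ _ (hxS.firstSign_eq ▸ hxS.sign_ne_zero) hxS.firstSign_eq
    have hx : x ≠ 0 := hxS.ne_zero
    refine ⟨hfirst, ?_⟩
    rw [lastSign_eq_firstSign_mul hBx, hBr, hfirst, lastSign_eq_firstSign_mul hx, mul_assoc]

theorem IsSR.hasMinorSigns {ε : Fin (min m n) → SignType} {A : Matrix (Fin m) (Fin n) ℝ}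
    (h : IsSR ε A) : HasMinorSigns (sgn ε) A := by
  intro r I J hdet
  rcases Nat.eq_zero_or_pos r with rfl | hr
  · simp [sgn]
  · have hrm : r ≤ m := by simpa using Fintype.card_le_of_embedding I.toEmbedding
    have hrn : r ≤ n := by simpa using Fintype.card_le_of_embedding J.toEmbedding
    exact h r hr (le_min hrm hrn) I J hdet

theorem mulVec_extend_zero_comp {R ι κ ι' κ' : Type*} [NonUnitalNonAssocSemiring R] [Fintype κ]
    [Fintype κ'] (A : Matrix ι κ R) (I : ι' → ι) {J : κ' → κ} (hJ : Function.Injective J)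
    (y : κ' → R) : (A *ᵥ Function.extend J y 0) ∘ I = A.submatrix I J *ᵥ y := by
  funext i
  refine (Fintype.sum_of_injective J hJ _ _ (fun j hj => ?_) fun j => ?_).symm
  · rw [Function.extend_apply' _ _ _ hj, Pi.zero_apply, mul_zero]
  · rw [hJ.extend_apply]
    rfl

theorem VDAt.submatrix {N p q : ℕ} {ε : Fin N → SignType} {A : Matrix (Fin m) (Fin n) ℝ}
    {J : Fin q ↪o Fin n} {y : Fin q → ℝ} (h : VDAt ε A (Function.extend J y 0))
    (I : Fin p ↪o Fin m) : VDAt ε (A.submatrix I J) y := by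
  rw [vdAt_iff_hasAlternation] at h ⊢
  intro k s hk hBy
  rw [← mulVec_extend_zero_comp A I J.injective] at hBy
  exact (h k s ((signChanges_extend_zero_le y J).trans hk) hBy.of_comp).of_extend_zero

theorem alternatesFrom_alternating {k : ℕ} {a : Fin k → ℝ} (ha : ∀ i, 0 < a i) :
    AlternatesFrom 1 (alternating a) :=
  ⟨one_ne_zero, fun j => by
    rw [alternating, sign_mul, sign_pow, Left.sign_neg, sign_one, sign_pos (ha j), mul_comm]⟩

theorem sign_det_of_vdAt_adjugate {N k : ℕ} {ε : Fin N → SignType}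
    {B : Matrix (Fin (k + 1)) (Fin (k + 1)) ℝ} {v : Fin (k + 1) → ℝ}
    (hminor : ∀ i j : Fin (k + 1), (B.submatrix i.succAbove j.succAbove).det ≠ 0 →
      SignType.sign (B.submatrix i.succAbove j.succAbove).det = sgn ε k)
    (hv : AlternatesFrom 1 v) (hvd : VDAt ε B (B.adjugate *ᵥ v)) (hdet : B.det ≠ 0) :
    SignType.sign B.det = sgn ε (k + 1) := by
  have hy : AlternatesFrom (sgn ε k) (B.adjugate *ᵥ v) := by
    simpa using alternatesFrom_adjugate_mulVec hminor hdet hv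
  have hBy : AlternatesFrom (SignType.sign B.det) (B *ᵥ B.adjugate *ᵥ v) := by
    refine ⟨sign_ne_zero.2 hdet, fun j => ?_⟩
    rw [mulVec_mulVec, mul_adjugate, smul_mulVec, one_mulVec, Pi.smul_apply, smul_eq_mul, sign_mul,
      hv.sign_apply, one_mul]
  have hy' := (vdAt_iff_hasAlternation.1 hvd k _ (signChanges_le _)
    hBy.hasAlternation).alternatesFrom
  have hsign := (hy.sign_apply 0).symm.trans (hy'.sign_apply 0)
  have cancel : ∀ d e t : SignType, d ≠ 0 → d = d * e * t → t = e := by decide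
  exact cancel _ _ _ hy.ne_zero (by simpa using hsign)

theorem isSR_of_vdAt_adjugate {ε : Fin (min m n) → SignType} {A : Matrix (Fin m) (Fin n) ℝ}
    {v : ∀ k : ℕ, (Fin k ↪o Fin m) → (Fin k ↪o Fin n) → Fin k → ℝ}
    (hv : ∀ k I J, AlternatesFrom 1 (v k I J))
    (h : ∀ k : ℕ, 1 ≤ k → k ≤ min m n → ∀ (I : Fin k ↪o Fin m) (J : Fin k ↪o Fin n),
      VDAt ε (A.submatrix I J) ((A.submatrix I J).adjugate *ᵥ v k I J)) : IsSR ε A := by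
  suffices hr : ∀ r ≤ min m n, ∀ (I : Fin r ↪o Fin m) (J : Fin r ↪o Fin n),
      (A.submatrix I J).det ≠ 0 → SignType.sign (A.submatrix I J).det = sgn ε r from
    fun r _ => hr r
  intro r
  induction r with
  | zero => simp [sgn]
  | succ k ih =>
    intro hk I J
    have hminor (i j : Fin (k + 1)) :=
      ih (by lia) ((Fin.succAboveOrderEmb i).trans I) ((Fin.succAboveOrderEmb j).trans J)
    exact sign_det_of_vdAt_adjugate hminor (hv _ I J) (h (k + 1) (by lia) hk I J)

end VariationDiminishing

end SignRegular

/-- A zero sign `ε_r` says that all `r × r` minors vanish. -/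
theorem theoremC_general {m n : ℕ} (A : Matrix (Fin m) (Fin n) ℝ) (ε : Fin (min m n) → SignType)
    (a : ∀ k : ℕ, (Fin k ↪o Fin m) → (Fin k ↪o Fin n) → Fin k → ℝ)
    (ha : ∀ k I J i, 0 < a k I J i) :
    List.TFAE [
      SignRegular.IsSR ε A,
      ∀ x : Fin n → ℝ, SignRegular.VDAt ε A x,
      ∀ k : ℕ, 1 ≤ k → k ≤ min m n → ∀ (I : Fin k ↪o Fin m) (J : Fin k ↪o Fin n),
        SignRegular.VDAt ε (A.submatrix I J)
          ((A.submatrix I J).adjugate.mulVec (SignRegular.alternating (a k I J)))] := by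
  tfae_have 1 → 2 := fun hA x => SignRegular.vdAt_iff_hasAlternation.2 fun _ _ _ =>
    hA.hasMinorSigns.hasAlternation_of_mulVec
  tfae_have 2 → 3 := fun h _ _ _ I _ => (h _).submatrix I
  tfae_have 3 → 1 := SignRegular.isSR_of_vdAt_adjugate fun k I J =>
    SignRegular.alternatesFrom_alternating (ha k I J)
  tfae_finish

/-- `a k I J` is the positive vector chosen for the `k × k` submatrix with rows `I` and columns
`J`; the equivalence holds for every such choice, so that one arbitrary alternating test vector
per square submatrix suffices. -/
theorem theoremC {m n : ℕ} (hm : 1 ≤ m) (hn : 1 ≤ n) (A : Matrix (Fin m) (Fin n) ℝ)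
    (ε : Fin (min m n) → SignType) (hε : ∀ i, ε i = 1 ∨ ε i = -1)
    (a : ∀ k : ℕ, (Fin k ↪o Fin m) → (Fin k ↪o Fin n) → Fin k → ℝ)
    (ha : ∀ k I J i, 0 < a k I J i) :
    List.TFAE [
      SignRegular.IsSR ε A,
      ∀ x : Fin n → ℝ, SignRegular.VDAt ε A x,
      ∀ k : ℕ, 1 ≤ k → k ≤ min m n → ∀ (I : Fin k ↪o Fin m) (J : Fin k ↪o Fin n),
        SignRegular.VDAt ε (A.submatrix I J)
          ((A.submatrix I J).adjugate.mulVec (SignRegular.alternating (a k I J)))] :=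
  theoremC_general A ε a ha
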